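/- Let $u_1,u_2\in H^1_{\mathrm{loc}}(\mathbb R^2)$ be real-valued functions that satisfy the $SU(3)$ Toda system $$-\Delta u_1=2e^{u_1}-e^{u_2},\qquad -\Delta u_2=-e^{u_1}+2e^{u_2}\qquad\text{on }\mathbb R^2$$ in the weak sense, i.e. $\int_{\mathbb R^2}\nabla u_1\cdot\nabla\varphi\,dx=\int_{\mathbb R^2}(2e^{u_1}-e^{u_2})\varphi\,dx$ and $\int_{\mathbb R^2}\nabla u_2\cdot\nabla\varphi\,dx=\int_{\mathbb R^2}(-e^{u_1}+2e^{u_2})\varphi\,dx$ for all $\varphi\in C_c^\infty(\mathbb R^2)$, and suppose that $$\alpha_1:=\int_{\mathbb R^2}e^{u_1}\,dx<\infty,\qquad \alpha_2:=\int_{\mathbb R^2}e^{u_2}\,dx<\infty .$$ Then $$\beta_1:=2\alpha_1-\alpha_2>4\pi,\qquad \beta_2:=2\alpha_2-\alpha_1>4\pi,$$ and consequently $\alpha_1>4\pi$ and $\alpha_2>4\pi$. -/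

import Mathlib

/-- The Euclidean plane `ℝ²`, with Lebesgue measure as its `volume`. -/
abbrev Plane : Type := EuclideanSpace ℝ (Fin 2)

/-- Test functions: real-valued smooth functions with compact support on the plane. -/
def IsTestFunction (φ : Plane → ℝ) : Prop :=
  ContDiff ℝ ((⊤ : ℕ∞) : WithTop ℕ∞) φ ∧ HasCompactSupport φ

/-- `f` belongs to `L²_loc(ℝ²)`: it is square integrable on every compact set. -/
def MemL2Loc {F : Type*} [NormedAddCommGroup F] (f : Plane → F) : Prop :=
  ∀ K : Set Plane, IsCompact K →
    MeasureTheory.MemLp f 2 (MeasureTheory.volume.restrict K)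

/-- `G` is a weak gradient of `u`: for every test function `φ` and every direction `v`,
`∫ u ∂_v φ = - ∫ ⟨G, v⟩ φ`. -/
def IsWeakGradient (u : Plane → ℝ) (G : Plane → Plane) : Prop :=
  ∀ φ : Plane → ℝ, IsTestFunction φ → ∀ v : Plane,
    ∫ x, u x * fderiv ℝ φ x v = -∫ x, inner ℝ (G x) v * φ x

/-- `u` belongs to `H¹_loc(ℝ²)` with weak gradient `G` (which is unique almost everywhere). -/
structure MemH1LocWith (u : Plane → ℝ) (G : Plane → Plane) : Prop where
  memL2Loc : MemL2Loc u
  memL2Loc_grad : MemL2Loc G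
  isWeakGradient : IsWeakGradient u G

/-- `u ∈ H¹_loc(ℝ²)` is a weak solution of `-Δ u = f` on `ℝ²`, where `f ∈ L¹_loc(ℝ²)`:
`∫ ∇u · ∇φ = ∫ f φ` for every test function `φ`. Here `fderiv ℝ φ x (G x)` is
`∇φ(x) · G(x)`. -/
def IsWeakPoissonSolution (u f : Plane → ℝ) : Prop :=
  MeasureTheory.LocallyIntegrable f ∧
  ∃ G : Plane → Plane, MemH1LocWith u G ∧
    ∀ φ : Plane → ℝ, IsTestFunction φ →
      ∫ x, fderiv ℝ φ x (G x) = ∫ x, f x * φ x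

/-- `(u₁, u₂) ∈ H¹_loc(ℝ²) × H¹_loc(ℝ²)` is an entire weak solution of the `SU(3)` Toda system
`-Δ u₁ = 2 e^{u₁} - e^{u₂}`, `-Δ u₂ = - e^{u₁} + 2 e^{u₂}` on `ℝ²`. -/
structure IsEntireTodaSolution (u₁ u₂ : Plane → ℝ) : Prop where
  eq₁ : IsWeakPoissonSolution u₁ (fun x => 2 * Real.exp (u₁ x) - Real.exp (u₂ x))
  eq₂ : IsWeakPoissonSolution u₂ (fun x => -Real.exp (u₁ x) + 2 * Real.exp (u₂ x))

/-- The mass `∫_{ℝ²} e^u` (used only where `e^u` is integrable). -/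
noncomputable def todaMass (u : Plane → ℝ) : ℝ := ∫ x, Real.exp (u x)

/-! The tool is the smooth mean of `u` over an annulus, indexed by the squared radius `R`. A
difference of two annular kernels is the Laplacian of a compactly supported radial potential, so
`-Δu = f` with `β = ∫ f` yields (`annularMean_add_log`) mean(R) + log R = mean(1) + (1 - β/4π) log R
+ ∫ f w_R. The weight `w_R`, which is `innerLogWeight R`, is nonnegative for `R ≥ 1` and bounded
both by `log R / 4π` and by a truncated logarithm independent of `R`. Jensen's inequality and
integrability of `e^u` send the left side to `-∞` (`tendsto_annularMean_add_log`). The last term is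
`o(log R)`, so `β < 4π` is impossible (`four_pi_le`).

Excluding equality uses the system. If `β₁ = β₂ = 4π`, adding the two identities leaves the weight
integrated against `f₁ + f₂ = e^{u₁} + e^{u₂} ≥ 0`, so the sum stays bounded below. If `β₁ = 4π <
β₂`, then `f₁ ≥ -e^{u₂}`, and the same contradiction follows once `e^{u₂}` is integrable against the
truncated logarithm; the other case is symmetric.

That integrability is the main work (`integrable_exp_mul_logCutoff`). The excess mass makes the
means of `u₂` around `x`, at radii comparable to `|x|`, at most `C - (2+δ) log |x|`. A Brezis–Merle
argument, based on the smallness of the mass near infinity, turns this into an integral bound on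
`e^{u₂}`. -/

open MeasureTheory Set Filter Topology

/-! ### One-dimensional profiles -/

/-- A smooth bump on the line centred at `3/2`, with support `(1, 2)`. -/
noncomputable def annularBump : ContDiffBump (3 / 2 : ℝ) := ⟨1 / 4, 1 / 2, by norm_num, by norm_num⟩

/-- A smooth probability density on the line, positive exactly on `(1, 2)`. -/
noncomputable def bumpDensity : ℝ → ℝ := annularBump.normed volume

/-- The maximal value of `bumpDensity`. -/
noncomputable def bumpMax : ℝ := 1 / ∫ x, annularBump x

lemma bumpDensity_contDiff : ContDiff ℝ ((⊤ : ℕ∞) : WithTop ℕ∞) bumpDensity :=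
  annularBump.contDiff_normed

lemma bumpDensity_continuous : Continuous bumpDensity := bumpDensity_contDiff.continuous

lemma bumpDensity_nonneg (t : ℝ) : 0 ≤ bumpDensity t := annularBump.nonneg_normed t

lemma bumpDensity_le (t : ℝ) : bumpDensity t ≤ bumpMax := by
  rw [bumpDensity, ContDiffBump.normed_def, bumpMax]
  exact div_le_div_of_nonneg_right annularBump.le_one annularBump.integral_pos.le

lemma bumpDensity_eq_bumpMax {t : ℝ} (h₁ : 5 / 4 ≤ t) (h₂ : t ≤ 7 / 4) :
    bumpDensity t = bumpMax := by
  rw [bumpDensity, ContDiffBump.normed_def, bumpMax, annularBump.one_of_mem_closedBall]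
  change t ∈ Metric.closedBall (3 / 2 : ℝ) (1 / 4)
  rw [Real.closedBall_eq_Icc]
  constructor <;> linarith

lemma bumpDensity_support : Function.support bumpDensity = Ioo 1 2 := by
  have h : Metric.ball (3 / 2 : ℝ) annularBump.rOut = Ioo 1 2 := by
    rw [Real.ball_eq_Ioo]; simp only [annularBump]; norm_num
  rw [← h]; exact annularBump.support_normed_eq

lemma bumpDensity_eq_zero_of_le {t : ℝ} (h : t ≤ 1) : bumpDensity t = 0 := by
  by_contra h'
  have : t ∈ Function.support bumpDensity := h'
  rw [bumpDensity_support] at this; linarith [this.1]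

lemma bumpDensity_eq_zero_of_ge {t : ℝ} (h : 2 ≤ t) : bumpDensity t = 0 := by
  by_contra h'
  have : t ∈ Function.support bumpDensity := h'
  rw [bumpDensity_support] at this; linarith [this.2]

lemma bumpDensity_integral : ∫ t, bumpDensity t = 1 := annularBump.integral_normed

/-- The distribution function of `bumpDensity`: a smooth transition from `0` to `1`. -/
noncomputable def transition (t : ℝ) : ℝ := ∫ s in (0 : ℝ)..t, bumpDensity s

lemma transition_hasDerivAt (t : ℝ) : HasDerivAt transition (bumpDensity t) t :=
  intervalIntegral.integral_hasDerivAt_right (bumpDensity_continuous.intervalIntegrable _ _)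
    bumpDensity_continuous.aestronglyMeasurable.stronglyMeasurableAtFilter
    bumpDensity_continuous.continuousAt

lemma transition_contDiff : ContDiff ℝ ((⊤ : ℕ∞) : WithTop ℕ∞) transition := by
  rw [contDiff_infty_iff_deriv]
  refine ⟨fun t => (transition_hasDerivAt t).differentiableAt, ?_⟩
  rw [show deriv transition = bumpDensity from funext fun t => (transition_hasDerivAt t).deriv]
  exact bumpDensity_contDiff

lemma transition_monotone : Monotone transition :=
  monotone_of_hasDerivAt_nonneg transition_hasDerivAt bumpDensity_nonneg

lemma transition_eq_zero {t : ℝ} (h : t ≤ 1) : transition t = 0 := by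
  rw [transition, intervalIntegral.integral_congr (g := fun _ => (0 : ℝ))]
  · simp
  · intro s hs
    refine bumpDensity_eq_zero_of_le (hs.2.trans ?_)
    simp [h]

lemma transition_eq_one {t : ℝ} (h : 2 ≤ t) : transition t = 1 := by
  rw [transition, intervalIntegral.integral_of_le (by linarith), ← bumpDensity_integral]
  refine setIntegral_eq_integral_of_forall_compl_eq_zero fun s hs => ?_
  by_cases h0 : s ≤ 1
  · exact bumpDensity_eq_zero_of_le h0
  · refine bumpDensity_eq_zero_of_ge ?_
    by_contra h2
    exact hs ⟨by linarith, by linarith⟩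

lemma transition_nonneg (t : ℝ) : 0 ≤ transition t := by
  rcases le_total t 1 with h | h
  · rw [transition_eq_zero h]
  · rw [← transition_eq_zero le_rfl]; exact transition_monotone h

lemma transition_le_one (t : ℝ) : transition t ≤ 1 := by
  rcases le_total 2 t with h | h
  · rw [transition_eq_one h]
  · rw [← transition_eq_one le_rfl]; exact transition_monotone h

lemma transition_div_contDiff :
    ContDiff ℝ ((⊤ : ℕ∞) : WithTop ℕ∞) (fun t => transition t / t) := by
  rw [contDiff_iff_contDiffAt]
  intro t
  by_cases ht : t = 0
  · have : (fun t => transition t / t) =ᶠ[𝓝 t] fun _ => (0 : ℝ) := by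
      filter_upwards [Iio_mem_nhds (show t < 1 by rw [ht]; norm_num)] with s hs
      rw [transition_eq_zero (le_of_lt hs), zero_div]
    exact contDiffAt_const.congr_of_eventuallyEq this
  · exact transition_contDiff.contDiffAt.div contDiffAt_id ht

/-- A smooth cut-off of the logarithm: it vanishes on `(-∞, 1]` and is `log t - c` on `[2, ∞)`. -/
noncomputable def logCutoff (t : ℝ) : ℝ := ∫ s in (0 : ℝ)..t, transition s / s

lemma logCutoff_hasDerivAt (t : ℝ) : HasDerivAt logCutoff (transition t / t) t :=
  have hc := transition_div_contDiff.continuous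
  intervalIntegral.integral_hasDerivAt_right (hc.intervalIntegrable _ _)
    hc.aestronglyMeasurable.stronglyMeasurableAtFilter hc.continuousAt

lemma logCutoff_contDiff : ContDiff ℝ ((⊤ : ℕ∞) : WithTop ℕ∞) logCutoff := by
  rw [contDiff_infty_iff_deriv]
  refine ⟨fun t => (logCutoff_hasDerivAt t).differentiableAt, ?_⟩
  rw [show deriv logCutoff = fun t => transition t / t from
    funext fun t => (logCutoff_hasDerivAt t).deriv]
  exact transition_div_contDiff

lemma logCutoff_continuous : Continuous logCutoff := logCutoff_contDiff.continuous

lemma logCutoff_monotone : Monotone logCutoff := by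
  refine monotone_of_hasDerivAt_nonneg logCutoff_hasDerivAt fun t => ?_
  rcases le_total t 1 with h | h
  · simp [transition_eq_zero h]
  · exact div_nonneg (transition_nonneg t) (by linarith)

lemma logCutoff_eq_zero {t : ℝ} (h : t ≤ 1) : logCutoff t = 0 := by
  rw [logCutoff, intervalIntegral.integral_congr (g := fun _ => (0 : ℝ))]
  · simp
  · intro s hs
    change transition s / s = 0
    rw [transition_eq_zero (hs.2.trans (by simp [h])), zero_div]

lemma logCutoff_nonneg (t : ℝ) : 0 ≤ logCutoff t := by
  rcases le_total t 1 with h | h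
  · rw [logCutoff_eq_zero h]
  · rw [← logCutoff_eq_zero le_rfl]; exact logCutoff_monotone h

/-- The difference between the logarithm and its cut-off. -/
noncomputable def logDefect (t : ℝ) : ℝ := Real.log t - logCutoff t

lemma logDefect_hasDerivAt {t : ℝ} (ht : 0 < t) :
    HasDerivAt logDefect ((1 - transition t) / t) t := by
  have := (Real.hasDerivAt_log ht.ne').sub (logCutoff_hasDerivAt t)
  rwa [show (1 - transition t) / t = t⁻¹ - transition t / t by ring]

lemma logDefect_monotoneOn : MonotoneOn logDefect (Ioi 0) := by
  refine monotoneOn_of_deriv_nonneg (convex_Ioi 0)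
    (fun t ht => (logDefect_hasDerivAt ht).continuousAt.continuousWithinAt)
    (fun t ht => ?_) fun t ht => ?_ <;> rw [interior_Ioi] at ht
  · exact (logDefect_hasDerivAt ht).differentiableAt.differentiableWithinAt
  · rw [(logDefect_hasDerivAt ht).deriv]
    exact div_nonneg (sub_nonneg.2 (transition_le_one t)) (le_of_lt ht)

/-- The derivative vanishes beyond 2, where `transition` is 1. This is what gives the radial
potential compact support. -/
lemma logDefect_eq_of_two_le {t : ℝ} (ht : 2 ≤ t) : logDefect t = logDefect 2 := by
  refine constant_of_has_deriv_right_zero (a := 2) (b := t)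
    (fun s hs => (logDefect_hasDerivAt (by linarith [hs.1])).continuousAt.continuousWithinAt)
    (fun s hs => ?_) t ⟨ht, le_rfl⟩
  have h := (logDefect_hasDerivAt (show 0 < s by linarith [hs.1])).hasDerivWithinAt (s := Ici s)
  rwa [transition_eq_one hs.1, sub_self, zero_div] at h

lemma logDefect_le_log_two {t : ℝ} (ht : 0 < t) : logDefect t ≤ Real.log 2 := by
  have h2 : logDefect 2 ≤ Real.log 2 := by
    have := logCutoff_nonneg 2
    simp only [logDefect]; linarith
  rcases le_total 2 t with h | h
  · rw [logDefect_eq_of_two_le h]; exact h2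
  · exact (logDefect_monotoneOn ht (mem_Ioi.2 two_pos) h).trans h2

lemma logCutoff_le_log {t : ℝ} (ht : 1 ≤ t) : logCutoff t ≤ Real.log t := by
  have h := logDefect_monotoneOn (mem_Ioi.2 one_pos) (mem_Ioi.2 (by linarith : (0 : ℝ) < t)) ht
  simp only [logDefect, Real.log_one, logCutoff_eq_zero le_rfl] at h
  linarith

/-- The radial profile of a compactly supported potential, as a function of `τ = ‖z‖²`: its
Laplacian is the difference of two annular kernels at the squared radii `a` and `b`. -/
noncomputable def potentialProfile (a b τ : ℝ) : ℝ :=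
  (4 * Real.pi)⁻¹ * (logCutoff (τ / b) - logCutoff (τ / a) + Real.log (b / a))

lemma potentialProfile_contDiff (a b : ℝ) :
    ContDiff ℝ ((⊤ : ℕ∞) : WithTop ℕ∞) (potentialProfile a b) :=
  contDiff_const.mul (((logCutoff_contDiff.comp (contDiff_id.div_const b)).sub
    (logCutoff_contDiff.comp (contDiff_id.div_const a))).add contDiff_const)

lemma potentialProfile_hasDerivAt {a b : ℝ} (ha : 0 < a) (hb : 0 < b) (τ : ℝ) :
    HasDerivAt (potentialProfile a b)
      ((4 * Real.pi)⁻¹ * ((transition (τ / b) - transition (τ / a)) / τ)) τ := by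
  have h (c : ℝ) (hc : 0 < c) :
      HasDerivAt (fun t => logCutoff (t / c)) (transition (τ / c) / τ) τ := by
    refine ((logCutoff_hasDerivAt (τ / c)).comp τ ((hasDerivAt_id τ).div_const c)).congr_deriv ?_
    rcases eq_or_ne τ 0 with rfl | h0
    · simp
    · field_simp
  exact ((((h b hb).sub (h a ha)).add_const (Real.log (b / a))).const_mul
    (4 * Real.pi)⁻¹).congr_deriv (by ring)

lemma potentialProfile_eq {a b τ : ℝ} (ha : 0 < a) (hb : 0 < b) (hτ : 0 < τ) :
    potentialProfile a b τ = (4 * Real.pi)⁻¹ * (logDefect (τ / a) - logDefect (τ / b)) := by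
  rw [potentialProfile, logDefect, logDefect, Real.log_div hb.ne' ha.ne',
    Real.log_div hτ.ne' hb.ne', Real.log_div hτ.ne' ha.ne']
  ring

lemma potentialProfile_eq_zero {a b τ : ℝ} (ha : 0 < a) (hab : a ≤ b) (hτ : 2 * b ≤ τ) :
    potentialProfile a b τ = 0 := by
  have hb := ha.trans_le hab
  rw [potentialProfile_eq ha hb (by linarith), logDefect_eq_of_two_le,
    logDefect_eq_of_two_le (t := τ / b), sub_self, mul_zero]
  · rwa [le_div_iff₀ hb]
  · rw [le_div_iff₀ ha]; linarith

lemma potentialProfile_nonneg {a b τ : ℝ} (ha : 0 < a) (hab : a ≤ b) (hτ : 0 ≤ τ) :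
    0 ≤ potentialProfile a b τ := by
  have hb := ha.trans_le hab
  rcases hτ.eq_or_lt with rfl | hτ
  · rw [potentialProfile, zero_div, zero_div, sub_self, zero_add]
    exact mul_nonneg (by positivity) (Real.log_nonneg ((one_le_div ha).2 hab))
  · rw [potentialProfile_eq ha hb hτ]
    refine mul_nonneg (by positivity) (sub_nonneg.2 ?_)
    exact logDefect_monotoneOn (div_pos hτ hb) (div_pos hτ ha)
      (div_le_div_of_nonneg_left hτ.le ha hab)

lemma potentialProfile_le {a b τ : ℝ} (ha : 0 < a) (hab : a ≤ b) (hτ : 0 ≤ τ) :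
    potentialProfile a b τ ≤ (4 * Real.pi)⁻¹ * Real.log (b / a) := by
  have := logCutoff_monotone (div_le_div_of_nonneg_left hτ ha hab)
  exact mul_le_mul_of_nonneg_left (by linarith) (by positivity)

/-- The bound does not involve `a`, unlike `potentialProfile_le`; this permits letting the inner
radius tend to zero later. -/
lemma potentialProfile_le_log {a b τ : ℝ} (ha : 0 < a) (hab : a ≤ b) (hτ : 0 < τ) :
    potentialProfile a b τ ≤
      (4 * Real.pi)⁻¹ * (Real.log 2 + max 0 (Real.log (b / τ))) := by
  have hb := ha.trans_le hab
  rw [potentialProfile_eq ha hb hτ]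
  refine mul_le_mul_of_nonneg_left ?_ (by positivity)
  have h1 := logDefect_le_log_two (div_pos hτ ha)
  have h2 : -logDefect (τ / b) ≤ max 0 (Real.log (b / τ)) := by
    rcases le_total (τ / b) 1 with h | h
    · refine le_max_of_le_right ?_
      rw [logDefect, logCutoff_eq_zero h, sub_zero, ← Real.log_inv, inv_div]
    · refine le_max_of_le_left ?_
      have := logCutoff_le_log h
      simp only [logDefect]; linarith
  linarith

/-! ### Radial kernels on the plane -/

/-- The annular probability kernel at squared radius `a`, supported in `a ≤ ‖z‖² ≤ 2a`. -/
noncomputable def annularKernel (a : ℝ) (z : Plane) : ℝ :=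
  (Real.pi * a)⁻¹ * bumpDensity (‖z‖ ^ 2 / a)

lemma annularKernel_continuous (a : ℝ) : Continuous (annularKernel a) :=
  continuous_const.mul (bumpDensity_continuous.comp (by fun_prop))

lemma annularKernel_nonneg {a : ℝ} (ha : 0 < a) (z : Plane) : 0 ≤ annularKernel a z :=
  mul_nonneg (by positivity) (bumpDensity_nonneg _)

lemma annularKernel_le {a : ℝ} (ha : 0 < a) (z : Plane) :
    annularKernel a z ≤ (Real.pi * a)⁻¹ * bumpMax :=
  mul_le_mul_of_nonneg_left (bumpDensity_le _) (by positivity)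

lemma annularKernel_eq_zero_of_le {a : ℝ} (ha : 0 < a) {z : Plane} (h : ‖z‖ ^ 2 ≤ a) :
    annularKernel a z = 0 := by
  rw [annularKernel, bumpDensity_eq_zero_of_le ((div_le_one ha).2 h), mul_zero]

lemma annularKernel_eq_zero_of_ge {a : ℝ} (ha : 0 < a) {z : Plane} (h : 2 * a ≤ ‖z‖ ^ 2) :
    annularKernel a z = 0 := by
  rw [annularKernel, bumpDensity_eq_zero_of_ge ((le_div_iff₀ ha).2 h), mul_zero]

lemma annularKernel_hasCompactSupport {a : ℝ} (ha : 0 < a) :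
    HasCompactSupport (annularKernel a) := by
  refine HasCompactSupport.intro (isCompact_closedBall (0 : Plane) (2 * a + 1)) fun z hz => ?_
  refine annularKernel_eq_zero_of_ge ha ?_
  rw [mem_closedBall_zero_iff, not_le] at hz
  nlinarith [norm_nonneg z]

/-- In polar coordinates the area element is `π d(r²)`, so substituting `t = r²` reduces the claim
to the total mass of `bumpDensity`. -/
lemma annularKernel_integral {a : ℝ} (ha : 0 < a) : ∫ z, annularKernel a z = 1 := by
  simp only [annularKernel]
  rw [integral_const_mul,
    integral_fun_norm_addHaar (E := Plane) volume (fun r : ℝ => bumpDensity (r ^ 2 / a))]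
  have hball : (volume : Measure Plane).real (Metric.ball 0 1) = Real.pi := by
    rw [Measure.real, EuclideanSpace.volume_ball_fin_two]
    simp [Real.pi_pos.le]
  have h1 : ∫ t in Ioi (0 : ℝ), bumpDensity t = 1 := by
    rw [← bumpDensity_integral]
    refine setIntegral_eq_integral_of_forall_compl_eq_zero fun s hs => ?_
    exact bumpDensity_eq_zero_of_le (by simp only [mem_Ioi, not_lt] at hs; linarith)
  have h2 : ∫ t in Ioi (0 : ℝ), bumpDensity (t / a) = a := by
    have := integral_comp_mul_right_Ioi bumpDensity 0 (inv_pos.2 ha)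
    simp only [zero_mul, inv_inv, h1, smul_eq_mul, mul_one] at this
    simpa only [div_eq_mul_inv] using this
  have h3 := integral_comp_rpow_Ioi_of_pos (g := fun t => bumpDensity (t / a)) two_pos
  rw [h2] at h3
  have h4 : ∫ y in Ioi (0 : ℝ), y ^ 1 • bumpDensity (y ^ 2 / a) = a / 2 := by
    rw [eq_div_iff two_ne_zero, ← integral_mul_const]
    refine Eq.trans ?_ h3
    refine setIntegral_congr_fun measurableSet_Ioi fun y hy => ?_
    norm_num
    ring
  rw [hball, finrank_euclideanSpace_fin, h4]
  simp only [nsmul_eq_mul, smul_eq_mul]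
  field_simp
  norm_num

lemma annularKernel_sub_integral {a : ℝ} (ha : 0 < a) (x : Plane) :
    ∫ y, annularKernel a (y - x) = 1 := by
  rw [integral_sub_right_eq_self (annularKernel a) x, annularKernel_integral ha]

lemma annularKernel_sub_continuous (a : ℝ) (x : Plane) :
    Continuous fun y => annularKernel a (y - x) :=
  (annularKernel_continuous a).comp (by fun_prop)

lemma annularKernel_sub_hasCompactSupport {a : ℝ} (ha : 0 < a) (x : Plane) :
    HasCompactSupport fun y => annularKernel a (y - x) :=
  (annularKernel_hasCompactSupport ha).comp_homeomorph (Homeomorph.subRight x)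

lemma annularKernel_sub_integrable {a : ℝ} (ha : 0 < a) (x : Plane) :
    Integrable fun y => annularKernel a (y - x) :=
  (annularKernel_sub_continuous a x).integrable_of_hasCompactSupport
    (annularKernel_sub_hasCompactSupport ha x)

/-! ### Weak solutions tested against radial potentials -/

lemma MemL2Loc.locallyIntegrable {F : Type*} [NormedAddCommGroup F] {f : Plane → F}
    (h : MemL2Loc f) : LocallyIntegrable f := by
  rw [locallyIntegrable_iff]
  intro K hK
  have : IsFiniteMeasure (volume.restrict K) := ⟨by simpa using hK.measure_lt_top⟩
  exact (h K hK).integrable one_le_two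

lemma IsTestFunction.fderiv_apply {φ : Plane → ℝ} (h : IsTestFunction φ) (v : Plane) :
    IsTestFunction fun y => fderiv ℝ φ y v := by
  refine ⟨?_, (h.2.fderiv_apply (𝕜 := ℝ) v)⟩
  exact (h.1.fderiv_right (m := ((⊤ : ℕ∞) : WithTop ℕ∞)) (by simp)).clm_apply contDiff_const

lemma integrable_mul_of_hasCompactSupport {u φ : Plane → ℝ} (hu : LocallyIntegrable u)
    (hφ : Continuous φ) (hc : HasCompactSupport φ) : Integrable fun y => u y * φ y := by
  simpa [mul_comm] using hu.integrable_smul_left_of_hasCompactSupport hφ hc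

/-- The Laplacian of a function on the plane, as a sum of pure second partial derivatives. -/
noncomputable def planeLaplacian (φ : Plane → ℝ) (y : Plane) : ℝ :=
  ∑ i : Fin 2, fderiv ℝ (fun z => fderiv ℝ φ z (EuclideanSpace.single i 1)) y
    (EuclideanSpace.single i 1)

/-- The partial derivatives of a test function are again test functions; applying the definition of
the weak gradient to each of them moves the second derivative off `u`. -/
lemma IsWeakPoissonSolution.integral_mul_laplacian {u f : Plane → ℝ}
    (h : IsWeakPoissonSolution u f) {φ : Plane → ℝ} (hφ : IsTestFunction φ) :
    ∫ y, u y * planeLaplacian φ y = -∫ y, f y * φ y := by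
  obtain ⟨_, G, hG, hw⟩ := h
  have hu := hG.memL2Loc.locallyIntegrable
  have hGl := hG.memL2Loc_grad.locallyIntegrable
  have hint (i : Fin 2) : Integrable fun y =>
      inner ℝ (G y) (EuclideanSpace.single i 1) *
        fderiv ℝ φ y (EuclideanSpace.single i 1) := by
    have hc := hφ.fderiv_apply (EuclideanSpace.single i 1)
    refine integrable_mul_of_hasCompactSupport ?_ hc.1.continuous hc.2
    intro x
    obtain ⟨s, hs, hi⟩ := hGl x
    exact ⟨s, hs, Integrable.inner_const hi _⟩
  simp only [planeLaplacian, Finset.mul_sum]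
  rw [integral_finsetSum, ← hw φ hφ]
  · simp only [hG.isWeakGradient _ (hφ.fderiv_apply _) _]
    rw [Finset.sum_neg_distrib, ← integral_finsetSum _ fun i _ => hint i]
    congr 2
    funext y
    have : G y = ∑ i : Fin 2, inner ℝ (G y) (EuclideanSpace.single i (1 : ℝ)) •
        (EuclideanSpace.single i 1 : Plane) := by
      ext j; fin_cases j <;> simp [EuclideanSpace.inner_single_right]
    conv_rhs => rw [this]
    simp only [map_sum, map_smul, smul_eq_mul]
  · intro i _
    have hc := (hφ.fderiv_apply (EuclideanSpace.single i 1)).fderiv_apply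
      (EuclideanSpace.single i 1)
    exact integrable_mul_of_hasCompactSupport hu hc.1.continuous hc.2

lemma planeLaplacian_radial {q q' q'' : ℝ → ℝ} (hq : ∀ t, HasDerivAt q (q' t) t)
    (hq' : ∀ t, HasDerivAt q' (q'' t) t) (x y : Plane) :
    planeLaplacian (fun z => q (‖z - x‖ ^ 2)) y =
      4 * (q' (‖y - x‖ ^ 2) + ‖y - x‖ ^ 2 * q'' (‖y - x‖ ^ 2)) := by
  have hn (z : Plane) : HasFDerivAt (fun z => ‖z - x‖ ^ 2)
      (2 • (innerSL ℝ (z - x))) z := by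
    simpa using ((hasFDerivAt_id z).sub_const x).norm_sq
  have hd (p p' : ℝ → ℝ) (hp : ∀ t, HasDerivAt p (p' t) t) (z : Plane) :
      HasFDerivAt (fun z => p (‖z - x‖ ^ 2))
        (p' (‖z - x‖ ^ 2) • (2 • (innerSL ℝ (z - x)))) z :=
    (hp _).comp_hasFDerivAt z (hn z)
  have h1 (v : Plane) : (fun z => fderiv ℝ (fun z => q (‖z - x‖ ^ 2)) z v) =
      fun z => q' (‖z - x‖ ^ 2) * (2 * inner ℝ (z - x) v) := by
    funext z
    rw [(hd q q' hq z).fderiv]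
    simp [-map_sub]
  have h2 (v : Plane) : fderiv ℝ (fun z => q' (‖z - x‖ ^ 2) * (2 * inner ℝ (z - x) v)) y v =
      q'' (‖y - x‖ ^ 2) * (2 * inner ℝ (y - x) v) ^ 2 + q' (‖y - x‖ ^ 2) * (2 * inner ℝ v v) := by
    have hl : HasFDerivAt (fun z => 2 * inner ℝ (z - x) v) ((2 : ℝ) • (innerSL ℝ v)) y := by
      have := (((innerSL ℝ v).hasFDerivAt (x := y - x)).comp y
        ((hasFDerivAt_id y).sub_const x)).const_mul (2 : ℝ)
      simpa [Function.comp_def, real_inner_comm] using this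
    have := congrArg (fun L => L v) ((hd q' q'' hq' y).mul hl).fderiv
    refine Eq.trans this ?_
    simp [-map_sub]
    ring
  simp only [planeLaplacian, h1, h2]
  have hs : ‖y - x‖ ^ 2 = (y - x) 0 ^ 2 + (y - x) 1 ^ 2 := by
    simp [EuclideanSpace.norm_sq_eq]
  simp only [Fin.sum_univ_two, EuclideanSpace.inner_single_right]
  generalize q'' (‖y - x‖ ^ 2) = A
  rw [hs]
  simp
  ring

lemma potentialProfile_isTestFunction {a b : ℝ} (ha : 0 < a) (hab : a ≤ b) (x : Plane) :
    IsTestFunction fun y => potentialProfile a b (‖y - x‖ ^ 2) := by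
  refine ⟨(potentialProfile_contDiff a b).comp
    ((contDiff_id.sub contDiff_const).norm_sq ℝ), ?_⟩
  refine HasCompactSupport.intro (isCompact_closedBall x (2 * b + 1)) fun z hz => ?_
  refine potentialProfile_eq_zero ha hab ?_
  rw [Metric.mem_closedBall, not_le, dist_eq_norm] at hz
  nlinarith [norm_nonneg (z - x)]

/-- In the variable `τ = r²` the radial Laplacian is `4 (τ q')'`, and here `τ q'` is a difference of
two transitions, with no division by `τ` left. -/
lemma planeLaplacian_potentialProfile {a b : ℝ} (ha : 0 < a) (hb : 0 < b) (x y : Plane) :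
    planeLaplacian (fun z => potentialProfile a b (‖z - x‖ ^ 2)) y =
      annularKernel b (y - x) - annularKernel a (y - x) := by
  have hd := potentialProfile_hasDerivAt ha hb
  -- The explicit first derivative divides by `τ`; its differentiability at zero is read off from
  -- the smoothness of the profile.
  have hsm := (contDiff_infty_iff_deriv.1 (potentialProfile_contDiff a b)).2
  rw [show deriv (potentialProfile a b) = _ from funext fun t => (hd t).deriv] at hsm
  have hd' := fun t => ((contDiff_infty_iff_deriv.1 hsm).1 t).hasDerivAt
  rw [planeLaplacian_radial hd hd' x y]
  set τ := ‖y - x‖ ^ 2 with hτ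
  have hprod := (hasDerivAt_id τ).mul (hd' τ)
  have hprod' : HasDerivAt (fun t => (4 * Real.pi)⁻¹ * (transition (t / b) - transition (t / a)))
      ((4 * Real.pi)⁻¹ * (bumpDensity (τ / b) * (1 / b) - bumpDensity (τ / a) * (1 / a))) τ :=
    ((((transition_hasDerivAt (τ / b)).comp τ ((hasDerivAt_id τ).div_const b)).sub
      ((transition_hasDerivAt (τ / a)).comp τ ((hasDerivAt_id τ).div_const a))).const_mul _)
  have heq : (id * fun t => (4 * Real.pi)⁻¹ * ((transition (t / b) - transition (t / a)) / t)) =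
      fun t => (4 * Real.pi)⁻¹ * (transition (t / b) - transition (t / a)) := by
    funext t
    rcases eq_or_ne t 0 with rfl | h0
    · simp
    · simp only [Pi.mul_apply, id]; field_simp
  rw [heq] at hprod
  have := hprod.unique hprod'
  simp only [id, one_mul] at this
  rw [this, annularKernel, annularKernel, ← hτ]
  field_simp

/-! ### Annular means -/

/-- The mean of `u` over the annulus around `x` of squared radius comparable to `a`. -/
noncomputable def annularMean (u : Plane → ℝ) (x : Plane) (a : ℝ) : ℝ :=
  ∫ y, u y * annularKernel a (y - x)

lemma potentialProfile_norm_le {a b τ : ℝ} (ha : 0 < a) (hab : a ≤ b) (hτ : 0 ≤ τ) :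
    ‖potentialProfile a b τ‖ ≤ (4 * Real.pi)⁻¹ * Real.log (b / a) := by
  rw [Real.norm_of_nonneg (potentialProfile_nonneg ha hab hτ)]
  exact potentialProfile_le ha hab hτ

lemma integrable_mul_potentialProfile {f : Plane → ℝ} (hf : Integrable f) {a b : ℝ} (ha : 0 < a)
    (hab : a ≤ b) (x : Plane) :
    Integrable fun y => f y * potentialProfile a b (‖y - x‖ ^ 2) :=
  hf.mul_bdd (potentialProfile_isTestFunction ha hab x).1.continuous.aestronglyMeasurable
    (ae_of_all _ fun _ => potentialProfile_norm_le ha hab (sq_nonneg _))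

lemma integrable_mul_annularKernel {u : Plane → ℝ} (hu : LocallyIntegrable u) {a : ℝ} (ha : 0 < a)
    (x : Plane) : Integrable fun y => u y * annularKernel a (y - x) :=
  integrable_mul_of_hasCompactSupport hu (annularKernel_sub_continuous a x)
    (annularKernel_sub_hasCompactSupport ha x)

lemma IsWeakPoissonSolution.locallyIntegrable {u f : Plane → ℝ} (h : IsWeakPoissonSolution u f) :
    LocallyIntegrable u := by
  obtain ⟨_, G, hG, _⟩ := h
  exact hG.memL2Loc.locallyIntegrable

lemma IsWeakPoissonSolution.annularMean_sub {u f : Plane → ℝ} (h : IsWeakPoissonSolution u f)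
    {a b : ℝ} (ha : 0 < a) (hab : a ≤ b) (x : Plane) :
    annularMean u x a - annularMean u x b =
      ∫ y, f y * potentialProfile a b (‖y - x‖ ^ 2) := by
  have hb := ha.trans_le hab
  have key := h.integral_mul_laplacian (potentialProfile_isTestFunction ha hab x)
  simp only [planeLaplacian_potentialProfile ha hb, mul_sub] at key
  rw [integral_sub (integrable_mul_annularKernel h.locallyIntegrable hb x)
    (integrable_mul_annularKernel h.locallyIntegrable ha x)] at key
  simp only [annularMean]
  linarith

/-! ### Jensen's inequality, and annular means at small and large radii. -/

lemma exp_integral_mul_le {α : Type*} [MeasurableSpace α] {μ : Measure α} {g w : α → ℝ}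
    (hw : ∀ x, 0 ≤ w x) (hwi : Integrable w μ) (hw1 : ∫ x, w x ∂μ = 1)
    (hg : Integrable (fun x => g x * w x) μ)
    (he : Integrable (fun x => Real.exp (g x) * w x) μ) :
    Real.exp (∫ x, g x * w x ∂μ) ≤ ∫ x, Real.exp (g x) * w x ∂μ := by
  set c := ∫ x, g x * w x ∂μ
  have h1 : ∫ x, Real.exp c * (w x + (g x * w x - c * w x)) ∂μ = Real.exp c := by
    rw [integral_const_mul, integral_add hwi
        (show Integrable (fun x => g x * w x - c * w x) μ from hg.sub (hwi.const_mul c)),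
      integral_sub hg (hwi.const_mul c), integral_const_mul, hw1]
    simp [c]
  rw [← h1]
  refine integral_mono ((hwi.add (hg.sub (hwi.const_mul c))).const_mul _) he fun x => ?_
  -- Tangent line of the exponential at the mean `c`; its linear term integrates to zero against
  -- `w`.
  have : Real.exp c * (1 + (g x - c)) ≤ Real.exp (g x) := by
    have h2 := Real.add_one_le_exp (g x - c)
    calc Real.exp c * (1 + (g x - c)) ≤ Real.exp c * Real.exp (g x - c) := by
          gcongr; linarith
      _ = Real.exp (g x) := by rw [← Real.exp_add]; congr 1; ring
  calc Real.exp c * (w x + (g x * w x - c * w x)) = Real.exp c * (1 + (g x - c)) * w x := by ring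
    _ ≤ _ := mul_le_mul_of_nonneg_right this (hw x)

lemma exp_annularMean_le {u : Plane → ℝ} (hu : LocallyIntegrable u)
    (he : Integrable fun y => Real.exp (u y)) {a : ℝ} (ha : 0 < a) (x : Plane) :
    Real.exp (annularMean u x a) ≤ ∫ y, Real.exp (u y) * annularKernel a (y - x) :=
  exp_integral_mul_le (fun _ => annularKernel_nonneg ha _) (annularKernel_sub_integrable ha x)
    (annularKernel_sub_integral ha x) (integrable_mul_annularKernel hu ha x)
    (integrable_mul_annularKernel he.locallyIntegrable ha x)

lemma volume_real_closedBall (x : Plane) {r : ℝ} (hr : 0 ≤ r) :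
    (volume : Measure Plane).real (Metric.closedBall x r) = r ^ 2 * Real.pi := by
  rw [Measure.real, EuclideanSpace.volume_closedBall_fin_two]
  simp [Real.pi_pos.le, hr]

/-- The kernel is at most `bumpMax / (πa)` and lives in a ball of area `2πa`, so the constant is
uniform in `a` and Lebesgue differentiation applies. -/
lemma abs_annularMean_sub_le {u : Plane → ℝ} (hu : LocallyIntegrable u) {a : ℝ} (ha : 0 < a)
    (x : Plane) :
    |annularMean u x a - u x| ≤
      2 * bumpMax * ⨍ y in Metric.closedBall x (√(2 * a)), ‖u y - u x‖ := by
  have hui : LocallyIntegrable fun y => u y - u x := hu.sub (locallyIntegrable_const _)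
  have hloc : IntegrableOn (fun y => ‖u y - u x‖) (Metric.closedBall x (√(2 * a))) :=
    (hui.integrableOn_isCompact (isCompact_closedBall _ _)).norm
  have h1 : annularMean u x a - u x = ∫ y, (u y - u x) * annularKernel a (y - x) := by
    simp only [sub_mul]
    rw [integral_sub (integrable_mul_annularKernel hu ha x)
      ((annularKernel_sub_integrable ha x).const_mul _), integral_const_mul,
      annularKernel_sub_integral ha, mul_one, annularMean]
  have hball : (volume : Measure Plane).real (Metric.closedBall x (√(2 * a))) =
      2 * a * Real.pi := by
    rw [volume_real_closedBall x (Real.sqrt_nonneg _), Real.sq_sqrt (by linarith)]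
  rw [h1, setAverage_eq, hball, ← Real.norm_eq_abs]
  calc ‖∫ y, (u y - u x) * annularKernel a (y - x)‖
      ≤ ∫ y in Metric.closedBall x (√(2 * a)), ‖(u y - u x) * annularKernel a (y - x)‖ := by
        rw [setIntegral_eq_integral_of_forall_compl_eq_zero]
        · exact norm_integral_le_integral_norm _
        · intro y hy
          rw [Metric.mem_closedBall, not_le, dist_eq_norm] at hy
          rw [annularKernel_eq_zero_of_ge ha (Real.lt_sq_of_sqrt_lt hy).le, mul_zero, norm_zero]
    _ ≤ ∫ y in Metric.closedBall x (√(2 * a)), (Real.pi * a)⁻¹ * bumpMax * ‖u y - u x‖ := by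
        refine integral_mono ((integrable_mul_annularKernel hui ha x).norm.integrableOn)
          (hloc.const_mul _) fun y => ?_
        simp only [norm_mul]
        rw [mul_comm, Real.norm_of_nonneg (annularKernel_nonneg ha _)]
        exact mul_le_mul_of_nonneg_right (annularKernel_le ha _) (norm_nonneg _)
    _ = _ := by
        rw [integral_const_mul, smul_eq_mul]
        field_simp

lemma ae_tendsto_annularMean {u : Plane → ℝ} (hu : LocallyIntegrable u) :
    ∀ᵐ x, Tendsto (fun a => annularMean u x a) (𝓝[>] 0) (𝓝 (u x)) := by
  filter_upwards [IsUnifLocDoublingMeasure.ae_tendsto_average_norm_sub volume hu 1] with x hx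
  have hδ : Tendsto (fun a : ℝ => √(2 * a)) (𝓝[>] 0) (𝓝[>] 0) := by
    refine tendsto_nhdsWithin_iff.2 ⟨?_, ?_⟩
    · have : Continuous fun a : ℝ => √(2 * a) := by fun_prop
      simpa using (this.tendsto 0).mono_left nhdsWithin_le_nhds
    · filter_upwards [self_mem_nhdsWithin] with a ha
      exact Real.sqrt_pos.2 (mul_pos two_pos ha)
  have h := (hx (fun _ => x) _ hδ (Eventually.of_forall fun a => by
    simp)).const_mul (2 * bumpMax)
  rw [mul_zero] at h
  rw [tendsto_iff_norm_sub_tendsto_zero]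
  refine squeeze_zero' (Eventually.of_forall fun _ => norm_nonneg _) ?_ h
  filter_upwards [self_mem_nhdsWithin] with a ha
  exact abs_annularMean_sub_le hu ha x

/-- By Jensen the exponential is at most `∫ e^u R k_R` with `k_R` the kernel; `R k_R` is bounded and
vanishes on `|y|² ≤ R`, so dominated convergence gives zero. -/
lemma tendsto_annularMean_add_log {u : Plane → ℝ} (hu : LocallyIntegrable u)
    (he : Integrable fun y => Real.exp (u y)) :
    Tendsto (fun R => annularMean u 0 R + Real.log R) atTop atBot := by
  rw [← Real.tendsto_exp_comp_nhds_zero]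
  have h : Tendsto (fun R => ∫ y, Real.exp (u y) * (R * annularKernel R (y - 0))) atTop
      (𝓝 (∫ _ : Plane, (0 : ℝ))) := by
    refine tendsto_integral_filter_of_dominated_convergence
      (fun y => Real.exp (u y) * (Real.pi⁻¹ * bumpMax)) ?_ ?_ (he.mul_const _) ?_
    · exact Eventually.of_forall fun R => he.aestronglyMeasurable.mul
        (continuous_const.mul (annularKernel_sub_continuous R 0)).aestronglyMeasurable
    · filter_upwards [eventually_gt_atTop 0] with R hR
      refine ae_of_all _ fun y => ?_
      rw [norm_mul, Real.norm_of_nonneg (Real.exp_pos _).le,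
        Real.norm_of_nonneg (mul_nonneg hR.le (annularKernel_nonneg hR _))]
      refine mul_le_mul_of_nonneg_left ?_ (Real.exp_pos _).le
      calc R * annularKernel R (y - 0) ≤ R * ((Real.pi * R)⁻¹ * bumpMax) :=
            mul_le_mul_of_nonneg_left (annularKernel_le hR _) hR.le
        _ = _ := by field_simp
    · refine ae_of_all _ fun y => tendsto_const_nhds.congr' ?_
      filter_upwards [eventually_gt_atTop 0, eventually_ge_atTop (‖y - 0‖ ^ 2)] with R hR hy
      rw [annularKernel_eq_zero_of_le hR hy, mul_zero, mul_zero]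
  rw [integral_zero] at h
  refine squeeze_zero' (Eventually.of_forall fun _ => (Real.exp_pos _).le) ?_ h
  filter_upwards [eventually_gt_atTop 0] with R hR
  rw [Real.exp_add, Real.exp_log hR, mul_comm]
  refine (mul_le_mul_of_nonneg_left (exp_annularMean_le hu he hR 0) hR.le).trans_eq ?_
  rw [← integral_const_mul]
  congr 1 with y
  ring

/-- The part of the logarithmic potential that stays bounded as the squared radius `R` grows. -/
noncomputable def innerLogWeight (R : ℝ) (y : Plane) : ℝ :=
  (4 * Real.pi)⁻¹ * (logCutoff (‖y‖ ^ 2) - logCutoff (‖y‖ ^ 2 / R))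

lemma innerLogWeight_continuous (R : ℝ) : Continuous (innerLogWeight R) := by
  have := logCutoff_continuous
  unfold innerLogWeight
  fun_prop

lemma innerLogWeight_eq (R : ℝ) (y : Plane) :
    innerLogWeight R y =
      (4 * Real.pi)⁻¹ * Real.log R - potentialProfile 1 R (‖y - 0‖ ^ 2) := by
  rw [innerLogWeight, potentialProfile, sub_zero, div_one, div_one]; ring

lemma innerLogWeight_nonneg {R : ℝ} (hR : 1 ≤ R) (y : Plane) : 0 ≤ innerLogWeight R y := by
  refine mul_nonneg (by positivity) (sub_nonneg.2 (logCutoff_monotone ?_))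
  exact div_le_self (sq_nonneg _) hR

lemma innerLogWeight_le_log {R : ℝ} (hR : 1 ≤ R) (y : Plane) :
    innerLogWeight R y ≤ (4 * Real.pi)⁻¹ * Real.log R := by
  rw [innerLogWeight_eq]
  linarith [potentialProfile_nonneg one_pos hR (sq_nonneg ‖y - 0‖)]

lemma innerLogWeight_le_logCutoff (R : ℝ) (y : Plane) :
    innerLogWeight R y ≤ (4 * Real.pi)⁻¹ * logCutoff (‖y‖ ^ 2) :=
  mul_le_mul_of_nonneg_left (by linarith [logCutoff_nonneg (‖y‖ ^ 2 / R)]) (by positivity)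

lemma integrable_mul_innerLogWeight {f : Plane → ℝ} (hf : Integrable f) {R : ℝ} (hR : 1 ≤ R) :
    Integrable fun y => f y * innerLogWeight R y :=
  hf.mul_bdd (c := (4 * Real.pi)⁻¹ * Real.log R)
    (innerLogWeight_continuous R).aestronglyMeasurable
    (ae_of_all _ fun y => by
      rw [Real.norm_of_nonneg (innerLogWeight_nonneg hR y)]; exact innerLogWeight_le_log hR y)

lemma IsWeakPoissonSolution.annularMean_add_log {u f : Plane → ℝ} (h : IsWeakPoissonSolution u f)
    (hf : Integrable f) {R : ℝ} (hR : 1 ≤ R) :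
    annularMean u 0 R + Real.log R = annularMean u 0 1 +
      (1 - (4 * Real.pi)⁻¹ * ∫ y, f y) * Real.log R + ∫ y, f y * innerLogWeight R y := by
  have h1 := h.annularMean_sub one_pos hR 0
  have h2 : ∫ y, f y * innerLogWeight R y = (∫ y, f y) * ((4 * Real.pi)⁻¹ * Real.log R) -
      ∫ y, f y * potentialProfile 1 R (‖y - 0‖ ^ 2) := by
    rw [← integral_mul_const,
      ← integral_sub (hf.mul_const _) (integrable_mul_potentialProfile hf one_pos hR 0)]
    congr 1 with y
    rw [innerLogWeight_eq]; ring
  rw [h2, ← h1]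
  ring

/-- Dominated convergence: the quotient of weight and `log R` is at most `1/4π`, and for fixed `y`
the weight stays bounded as `R` grows. -/
lemma tendsto_integral_innerLogWeight_div_log {f : Plane → ℝ} (hf : Integrable f) :
    Tendsto (fun R => (∫ y, f y * innerLogWeight R y) / Real.log R) atTop (𝓝 0) := by
  have h : Tendsto (fun R => ∫ y, f y * (innerLogWeight R y / Real.log R)) atTop
      (𝓝 (∫ _ : Plane, (0 : ℝ))) := by
    refine tendsto_integral_filter_of_dominated_convergence
      (fun y => ‖f y‖ * (4 * Real.pi)⁻¹) ?_ ?_ (hf.norm.mul_const _) ?_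
    · exact Eventually.of_forall fun R => hf.aestronglyMeasurable.mul
        ((innerLogWeight_continuous R).div_const _).aestronglyMeasurable
    · filter_upwards [eventually_gt_atTop 1] with R hR
      refine ae_of_all _ fun y => ?_
      have hlog := Real.log_pos hR
      rw [norm_mul, Real.norm_of_nonneg (div_nonneg (innerLogWeight_nonneg hR.le y) hlog.le)]
      refine mul_le_mul_of_nonneg_left ?_ (norm_nonneg _)
      rw [div_le_iff₀ hlog]
      exact innerLogWeight_le_log hR.le y
    · refine ae_of_all _ fun y => ?_
      have h0 : Tendsto (fun R => innerLogWeight R y / Real.log R) atTop (𝓝 0) := by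
        have h1 : Tendsto (fun R => (4 * Real.pi)⁻¹ * logCutoff (‖y‖ ^ 2) / Real.log R) atTop
            (𝓝 0) := tendsto_const_nhds.div_atTop Real.tendsto_log_atTop
        refine squeeze_zero' ?_ ?_ h1
        · filter_upwards [eventually_gt_atTop 1] with R hR
          exact div_nonneg (innerLogWeight_nonneg hR.le y) (Real.log_pos hR).le
        · filter_upwards [eventually_gt_atTop 1] with R hR
          exact div_le_div_of_nonneg_right (innerLogWeight_le_logCutoff R y) (Real.log_pos hR).le
      simpa using h0.const_mul (f y)
  rw [integral_zero] at h
  refine h.congr fun R => ?_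
  rw [← integral_div]
  congr 1 with y
  rw [mul_div_assoc]

/-! ### Decay of a supercritical solution -/

lemma IsWeakPoissonSolution.exists_annularMean_le_neg_log {u f : Plane → ℝ}
    (h : IsWeakPoissonSolution u f) (hf : Integrable f) (hβ : 4 * Real.pi < ∫ y, f y) :
    ∃ δ > 0, ∀ᶠ R in atTop, annularMean u 0 R + Real.log R ≤ -δ * Real.log R := by
  set d := (4 * Real.pi)⁻¹ * (∫ y, f y) - 1 with hd
  have hd0 : 0 < d := by
    rw [hd, sub_pos, inv_mul_eq_div, one_lt_div (by positivity)]; exact hβ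
  -- Half of the excess `d` absorbs the `o(log R)` terms.
  refine ⟨d / 2, by positivity, ?_⟩
  have h1 : Tendsto (fun R => annularMean u 0 1 / Real.log R +
      (∫ y, f y * innerLogWeight R y) / Real.log R) atTop (𝓝 0) := by
    simpa using (tendsto_const_nhds.div_atTop Real.tendsto_log_atTop).add
      (tendsto_integral_innerLogWeight_div_log hf)
  filter_upwards [h1.eventually (gt_mem_nhds (half_pos hd0)), eventually_gt_atTop 1] with R h2 hR
  rw [← add_div, div_lt_iff₀ (Real.log_pos hR)] at h2
  rw [h.annularMean_add_log hf hR.le,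
    show 1 - (4 * Real.pi)⁻¹ * ∫ y, f y = -d by rw [hd]; ring]
  linarith

/-- The left kernel lives in `|y| ≤ |x|/20`. There `|y-x|²/|x|²` lies between `(19/20)²` and
`(21/20)²`, and division by `25/36` lands in the plateau `[5/4, 7/4]` of the bump. The factor
`10000/9` is the ratio of the two squared radii. -/
lemma annularKernel_le_annularKernel_sub {x : Plane} (hx : 0 < ‖x‖) (y : Plane) :
    annularKernel (‖x‖ ^ 2 / 1600) y ≤
      10000 / 9 * annularKernel (25 / 36 * ‖x‖ ^ 2) (y - x) := by
  have hx2 : 0 < ‖x‖ ^ 2 := by positivity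
  by_cases hy : 2 * (‖x‖ ^ 2 / 1600) ≤ ‖y‖ ^ 2
  · rw [annularKernel_eq_zero_of_ge (by positivity) hy]
    exact mul_nonneg (by norm_num) (annularKernel_nonneg (by positivity) _)
  · have hy' : ‖y‖ ≤ ‖x‖ / 20 := by
      refine abs_le_of_sq_le_sq' ?_ (by positivity) |>.2
      nlinarith
    have h1 : ‖y - x‖ ≤ 21 / 20 * ‖x‖ := by linarith [norm_sub_le y x]
    have h2 : 19 / 20 * ‖x‖ ≤ ‖y - x‖ := by
      have := norm_sub_norm_le x y
      rw [norm_sub_rev] at this; linarith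
    have h3 : ‖y - x‖ ^ 2 ≤ (21 / 20 * ‖x‖) ^ 2 := by gcongr
    have h4 : (19 / 20 * ‖x‖) ^ 2 ≤ ‖y - x‖ ^ 2 := by gcongr
    refine (annularKernel_le (by positivity) y).trans_eq ?_
    rw [annularKernel, bumpDensity_eq_bumpMax]
    · field_simp; ring
    · rw [le_div_iff₀ (by positivity)]; nlinarith
    · rw [div_le_iff₀ (by positivity)]; nlinarith

/-- The kernel around `x` splits into `9/10000` of the kernel around the origin and a nonnegative
remainder. On the remainder `u + log R ≤ R e^u` is used, which costs only a multiple of the mass. -/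
lemma annularMean_le_of_annularMean_zero {u : Plane → ℝ} (hu : LocallyIntegrable u)
    (he : Integrable fun y => Real.exp (u y)) {x : Plane} (hx : 0 < ‖x‖) :
    annularMean u x (25 / 36 * ‖x‖ ^ 2) + Real.log (‖x‖ ^ 2 / 1600) ≤
      9 / 10000 * (annularMean u 0 (‖x‖ ^ 2 / 1600) + Real.log (‖x‖ ^ 2 / 1600)) +
        9 / 10000 * Real.pi⁻¹ * bumpMax * ∫ y, Real.exp (u y) := by
  set R := ‖x‖ ^ 2 / 1600 with hR
  set R' := 25 / 36 * ‖x‖ ^ 2 with hR'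
  have hR0 : 0 < R := by positivity
  have hR0' : 0 < R' := by positivity
  have hi := integrable_mul_annularKernel hu hR0 0
  have hi' := integrable_mul_annularKernel hu hR0' x
  have hj := (annularKernel_sub_integrable hR0 0).const_mul (Real.log R)
  have hj' := (annularKernel_sub_integrable hR0' x).const_mul (Real.log R)
  have e1 : annularMean u x R' + Real.log R =
      ∫ y, (u y * annularKernel R' (y - x) + Real.log R * annularKernel R' (y - x)) := by
    rw [integral_add hi' hj', integral_const_mul, annularKernel_sub_integral hR0', mul_one,
      annularMean]
  have e2 : annularMean u 0 R + Real.log R =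
      ∫ y, (u y * annularKernel R (y - 0) + Real.log R * annularKernel R (y - 0)) := by
    rw [integral_add hi hj, integral_const_mul, annularKernel_sub_integral hR0, mul_one,
      annularMean]
  have hs : Integrable fun y => 9 / 10000 *
      (u y * annularKernel R (y - 0) + Real.log R * annularKernel R (y - 0)) :=
    (hi.add hj).const_mul _
  have hc := he.const_mul (9 / 10000 * Real.pi⁻¹ * bumpMax)
  rw [e1, e2, ← integral_const_mul, ← integral_const_mul (9 / 10000 * Real.pi⁻¹ * bumpMax),
    ← integral_add hs hc]
  refine integral_mono (hi'.add hj') (hs.add hc) fun y => ?_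
  have hk := annularKernel_le_annularKernel_sub hx y
  rw [← hR, ← hR'] at hk
  have hk0 := annularKernel_nonneg hR0 y
  have hkM := annularKernel_le hR0' (y - x)
  have hexp : u y + Real.log R ≤ R * Real.exp (u y) := by
    have := Real.add_one_le_exp (u y + Real.log R)
    rw [Real.exp_add, Real.exp_log hR0] at this
    linarith
  have hpos : 0 ≤ R * Real.exp (u y) := by positivity
  have hRR : R * ((Real.pi * R')⁻¹ * bumpMax) = 9 / 10000 * Real.pi⁻¹ * bumpMax := by
    rw [hR, hR']; field_simp; ring
  simp only [sub_zero]
  set k := annularKernel R y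
  set k' := annularKernel R' (y - x)
  have h1 : (u y + Real.log R) * (k' - 9 / 10000 * k) ≤
      R * Real.exp (u y) * (k' - 9 / 10000 * k) :=
    mul_le_mul_of_nonneg_right hexp (by linarith)
  have h2 : R * Real.exp (u y) * (k' - 9 / 10000 * k) ≤
      R * Real.exp (u y) * ((Real.pi * R')⁻¹ * bumpMax) :=
    mul_le_mul_of_nonneg_left (by linarith) hpos
  have h3 : R * Real.exp (u y) * ((Real.pi * R')⁻¹ * bumpMax) =
      9 / 10000 * Real.pi⁻¹ * bumpMax * Real.exp (u y) := by
    rw [← hRR]; ring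
  linarith

lemma IsWeakPoissonSolution.exists_annularMean_le_log {u f : Plane → ℝ}
    (h : IsWeakPoissonSolution u f) (hf : Integrable f) (hβ : 4 * Real.pi < ∫ y, f y)
    (he : Integrable fun y => Real.exp (u y)) :
    ∃ δ > 0, ∃ C, ∀ᶠ ρ in atTop, ∀ x : Plane, ρ ≤ ‖x‖ →
      annularMean u x (‖x‖ ^ 2 / 16) ≤ C - (2 + δ) * Real.log ‖x‖ := by
  obtain ⟨δ, hδ, hR⟩ := h.exists_annularMean_le_neg_log hf hβ
  obtain ⟨R₀, hR₀⟩ := eventually_atTop.1 hR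
  set B := 9 / 10000 * Real.pi⁻¹ * bumpMax * ∫ y, Real.exp (u y)
  set D := (∫ y, ‖f y‖) * ((4 * Real.pi)⁻¹ * Real.log (100 / 9))
  -- The doubling and `log 1600` come from `log R = 2 log |x| - log 1600`; `D` pays for shrinking
  -- the squared radius from `25/36 |x|²` to `|x|²/16`.
  refine ⟨2 * (9 / 10000 * δ), by positivity, B + D + (1 + 9 / 10000 * δ) * Real.log 1600, ?_⟩
  filter_upwards [eventually_ge_atTop (1600 * |R₀| + 1)] with ρ hρ x hx
  have hx1 : 1 ≤ ‖x‖ := by linarith [abs_nonneg R₀]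
  have hx0 : 0 < ‖x‖ := by linarith
  have hx2 : 0 < ‖x‖ ^ 2 := by positivity
  have h1 := annularMean_le_of_annularMean_zero h.locallyIntegrable he hx0
  have h2 := hR₀ (‖x‖ ^ 2 / 1600) (by
    rw [le_div_iff₀ (by norm_num)]
    nlinarith [le_abs_self R₀])
  have h3 := h.annularMean_sub (a := ‖x‖ ^ 2 / 16) (b := 25 / 36 * ‖x‖ ^ 2) (by positivity)
    (by linarith) x
  have h4 : ∫ y, f y * potentialProfile (‖x‖ ^ 2 / 16) (25 / 36 * ‖x‖ ^ 2) (‖y - x‖ ^ 2) ≤ D := by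
    simp only [D]
    rw [← integral_mul_const]
    refine integral_mono (integrable_mul_potentialProfile hf (by positivity) (by linarith) x)
      (hf.norm.mul_const _) fun y => ?_
    have hb := potentialProfile_norm_le (a := ‖x‖ ^ 2 / 16) (b := 25 / 36 * ‖x‖ ^ 2)
      (by positivity) (by linarith) (sq_nonneg ‖y - x‖)
    rw [show 25 / 36 * ‖x‖ ^ 2 / (‖x‖ ^ 2 / 16) = 100 / 9 by field_simp; norm_num] at hb
    refine (Real.le_norm_self _).trans ?_
    rw [norm_mul]
    exact mul_le_mul_of_nonneg_left hb (norm_nonneg _)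
  have h5 : Real.log (‖x‖ ^ 2 / 1600) = 2 * Real.log ‖x‖ - Real.log 1600 := by
    rw [Real.log_div hx2.ne' (by norm_num), Real.log_pow]; norm_num
  rw [h5] at h1 h2
  change _ ≤ _ + B at h1
  linarith

/-! ### A Brezis–Merle bound for `e^u` far from the origin. -/

lemma two_mul_potentialProfile_le_log {m a ρ s : ℝ} (hm : m ≤ Real.pi) (ha : 0 < a)
    (haρ : a ≤ ρ ^ 2 / 16) (hρ : 0 < ρ) (hs : 0 < s) :
    Real.exp (m * (2 * potentialProfile a (ρ ^ 2 / 16) (s ^ 2))) ≤ 2 * (1 + ρ / s) := by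
  have hb : 0 < ρ / s := by positivity
  rw [← Real.le_log_iff_exp_le (by positivity)]
  have h1 := potentialProfile_le_log ha haρ (show 0 < s ^ 2 by positivity)
  have h2 : Real.log 2 + max 0 (Real.log (ρ ^ 2 / 16 / s ^ 2)) ≤
      2 * Real.log (2 * (1 + ρ / s)) := by
    rw [show 2 * Real.log (2 * (1 + ρ / s)) = Real.log ((2 * (1 + ρ / s)) ^ 2) by
      rw [Real.log_pow]; norm_num]
    rcases max_cases 0 (Real.log (ρ ^ 2 / 16 / s ^ 2)) with ⟨h, _⟩ | ⟨h, _⟩ <;> rw [h]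
    · rw [add_zero]
      exact Real.log_le_log two_pos (by nlinarith)
    · rw [← Real.log_mul two_ne_zero (by positivity)]
      refine Real.log_le_log (by positivity) ?_
      rw [show ρ ^ 2 / 16 / s ^ 2 = (ρ / s) ^ 2 / 16 by field_simp]
      nlinarith
  have hκ := potentialProfile_nonneg ha haρ (sq_nonneg s)
  calc m * (2 * potentialProfile a (ρ ^ 2 / 16) (s ^ 2))
      ≤ Real.pi * (2 * potentialProfile a (ρ ^ 2 / 16) (s ^ 2)) := by gcongr
    -- With `m ≤ π` the singularity after exponentiation is only `1/s`, which is integrable in the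
    -- plane.
    _ ≤ Real.pi * (2 * ((4 * Real.pi)⁻¹ * (2 * Real.log (2 * (1 + ρ / s))))) := by
        have h3 := h1.trans (mul_le_mul_of_nonneg_left h2
          (show 0 ≤ (4 * Real.pi)⁻¹ by positivity))
        have := Real.pi_pos
        gcongr
    _ = _ := by field_simp; ring

/-- Since `f ≤ 2 e^u`, the potential term is at most an average of `2mκ` for the probability measure
`e^u/m` on the exterior region, and Jensen moves the exponential inside. The bound is independent of
`a`. -/
lemma exp_annularMean_le_lintegral {u f : Plane → ℝ} (h : IsWeakPoissonSolution u f)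
    (hf : Integrable f) (hle : ∀ y, f y ≤ 2 * Real.exp (u y))
    (he : Integrable fun y => Real.exp (u y)) {m ρ : ℝ} (hρ : 0 < ρ)
    (hm : ∫ y in {y : Plane | ρ / 2 < ‖y‖}, Real.exp (u y) = m) (hm0 : 0 < m) (hmπ : m ≤ Real.pi)
    {x : Plane} (hx : ρ ≤ ‖x‖) {a : ℝ} (ha : 0 < a) (hax : a ≤ ‖x‖ ^ 2 / 16) :
    ENNReal.ofReal (Real.exp (annularMean u x a)) ≤
      ENNReal.ofReal (Real.exp (annularMean u x (‖x‖ ^ 2 / 16))) *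
        ∫⁻ y, ENNReal.ofReal (2 * (1 + ‖x‖ / ‖y - x‖)) * ENNReal.ofReal (Real.exp (u y) / m) := by
  set E := {y : Plane | ρ / 2 < ‖y‖} with hE
  have hEm : MeasurableSet E := measurableSet_lt measurable_const measurable_norm
  have hx0 : 0 < ‖x‖ := hρ.trans_le hx
  set κ : Plane → ℝ := fun y => potentialProfile a (‖x‖ ^ 2 / 16) (‖y - x‖ ^ 2) with hκ
  have hκ0 (y : Plane) : 0 ≤ κ y := potentialProfile_nonneg ha hax (sq_nonneg _)
  have hκc : Continuous κ := (potentialProfile_isTestFunction ha hax x).1.continuous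
  have hκb (y : Plane) : ‖κ y‖ ≤ (4 * Real.pi)⁻¹ * Real.log (‖x‖ ^ 2 / 16 / a) :=
    potentialProfile_norm_le ha hax (sq_nonneg _)
  -- The outer squared radius `|x|²/16` is small enough that the potential vanishes for `|y-x| ≥
  -- |x|/2`, so only the mass far from the origin enters.
  have hκE (y : Plane) (hy : y ∉ E) : κ y = 0 := by
    refine potentialProfile_eq_zero ha hax ?_
    have h1 : ‖y‖ ≤ ρ / 2 := not_lt.1 hy
    have h2 : ‖x‖ / 2 ≤ ‖y - x‖ := by
      have := norm_sub_norm_le x y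
      rw [norm_sub_rev] at this; linarith
    nlinarith
  have hiE : Integrable (fun y => Real.exp (u y) / m) (volume.restrict E) :=
    (he.div_const m).integrableOn
  have hig : Integrable (fun y => m * (2 * κ y) * (Real.exp (u y) / m)) (volume.restrict E) := by
    refine hiE.bdd_mul (c := m * (2 * ((4 * Real.pi)⁻¹ * Real.log (‖x‖ ^ 2 / 16 / a))))
      (continuous_const.mul (continuous_const.mul hκc)).aestronglyMeasurable
      (ae_of_all _ fun y => ?_)
    rw [norm_mul, norm_mul, Real.norm_of_nonneg hm0.le, Real.norm_two]
    gcongr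
    exact hκb y
  have hie : Integrable (fun y => Real.exp (m * (2 * κ y)) * (Real.exp (u y) / m))
      (volume.restrict E) := by
    refine hiE.bdd_mul
      (c := Real.exp (m * (2 * ((4 * Real.pi)⁻¹ * Real.log (‖x‖ ^ 2 / 16 / a)))))
      (Real.continuous_exp.comp (continuous_const.mul (continuous_const.mul
        hκc))).aestronglyMeasurable (ae_of_all _ fun y => ?_)
    rw [Real.norm_of_nonneg (Real.exp_pos _).le]
    gcongr
    exact (Real.le_norm_self _).trans (hκb y)
  have hw1 : ∫ y in E, Real.exp (u y) / m = 1 := by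
    rw [integral_div, hm, div_self hm0.ne']
  have hJ := exp_integral_mul_le (fun y => div_nonneg (Real.exp_pos (u y)).le hm0.le) hiE hw1
    hig hie
  have hmean : annularMean u x a ≤ annularMean u x (‖x‖ ^ 2 / 16) +
      ∫ y in E, m * (2 * κ y) * (Real.exp (u y) / m) := by
    have h1 := h.annularMean_sub ha hax x
    have h2 : ∫ y, f y * κ y ≤ ∫ y in E, m * (2 * κ y) * (Real.exp (u y) / m) := by
      have h3 : ∫ y, f y * κ y = ∫ y in E, f y * κ y :=
        (setIntegral_eq_integral_of_forall_compl_eq_zero fun y hy => by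
          rw [hκE y hy, mul_zero]).symm
      rw [h3]
      refine integral_mono (integrable_mul_potentialProfile hf ha hax x).integrableOn hig
        fun y => (mul_le_mul_of_nonneg_right (hle y) (hκ0 y)).trans_eq ?_
      field_simp
    linarith
  calc ENNReal.ofReal (Real.exp (annularMean u x a))
      ≤ ENNReal.ofReal (Real.exp (annularMean u x (‖x‖ ^ 2 / 16)) *
          ∫ y in E, Real.exp (m * (2 * κ y)) * (Real.exp (u y) / m)) := by
        refine ENNReal.ofReal_le_ofReal ?_
        refine (Real.exp_le_exp.2 hmean).trans ?_
        rw [Real.exp_add]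
        gcongr
    _ = ENNReal.ofReal (Real.exp (annularMean u x (‖x‖ ^ 2 / 16))) *
          ∫⁻ y in E, ENNReal.ofReal (Real.exp (m * (2 * κ y)) * (Real.exp (u y) / m)) := by
        rw [ENNReal.ofReal_mul (Real.exp_pos _).le, ofReal_integral_eq_lintegral_ofReal hie
          (ae_of_all _ fun y => by positivity)]
    _ ≤ _ := by
        refine mul_le_mul' le_rfl ?_
        refine (setLIntegral_le_lintegral _ _).trans (lintegral_mono_ae ?_)
        filter_upwards [compl_mem_ae_iff.2 (measure_singleton (μ := volume) x)] with y hy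
        have hs : 0 < ‖y - x‖ := norm_pos_iff.2 (sub_ne_zero.2 hy)
        rw [← ENNReal.ofReal_mul (by positivity)]
        refine ENNReal.ofReal_le_ofReal ?_
        gcongr
        exact two_mul_potentialProfile_le_log hmπ ha hax hx0 hs

/-- A radial function on the plane, integrable both at the origin and at infinity. -/
noncomputable def radialMajorant (δ : ℝ) (z : Plane) : ℝ :=
  if ‖z‖ < 1 then ‖z‖⁻¹ else ‖z‖ ^ (-(2 + δ))

lemma radialMajorant_nonneg (δ : ℝ) (z : Plane) : 0 ≤ radialMajorant δ z := by
  unfold radialMajorant; split_ifs <;> positivity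

lemma radialMajorant_integrable {δ : ℝ} (hδ : 0 < δ) : Integrable (radialMajorant δ) := by
  refine (integrable_fun_norm_addHaar (E := Plane) volume
    (f := fun r : ℝ => if r < 1 then r⁻¹ else r ^ (-(2 + δ)))).2 ?_
  rw [finrank_euclideanSpace_fin, ← Ioc_union_Ioi_eq_Ioi zero_le_one]
  refine IntegrableOn.union ?_ ?_
  · rw [integrableOn_Ioc_iff_integrableOn_Ioo]
    refine IntegrableOn.congr_fun (f := fun _ => (1 : ℝ)) ?_ (fun r hr => ?_) measurableSet_Ioo
    · exact integrableOn_const (by simp)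
    · simp [hr.2, hr.1.ne']
  · refine IntegrableOn.congr_fun
      (integrableOn_Ioi_rpow_of_lt (show -(1 + δ) < -1 by linarith) one_pos) (fun r hr => ?_)
      measurableSet_Ioi
    have hr0 : (0 : ℝ) < r := one_pos.trans hr
    rw [if_neg (not_lt.2 (mem_Ioi.1 hr).le), smul_eq_mul]
    rw [show -(1 + δ) = 1 + -(2 + δ) by ring, Real.rpow_add hr0]
    norm_num

lemma rpow_mul_le_radialMajorant {δ : ℝ} (hδ : 0 < δ) {x y : Plane} (hx : 1 ≤ ‖x‖) :
    ‖x‖ ^ (-(2 + δ)) * (1 + ‖x‖ / ‖y - x‖) ≤ 2 * radialMajorant δ x + radialMajorant δ (x - y) := by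
  have hx0 : 0 < ‖x‖ := by linarith
  have h1 : radialMajorant δ x = ‖x‖ ^ (-(2 + δ)) := by
    rw [radialMajorant, if_neg (not_lt.2 hx)]
  have hG := radialMajorant_nonneg δ (x - y)
  rw [h1, mul_add, mul_one, norm_sub_rev y x]
  have hp : 0 < ‖x‖ ^ (-(2 + δ)) := by positivity
  have h2 : ‖x‖ ^ (-(2 + δ)) * (‖x‖ / ‖x - y‖) = ‖x‖ ^ (-(1 + δ)) * ‖x - y‖⁻¹ := by
    rw [show -(1 + δ) = -(2 + δ) + 1 by ring, Real.rpow_add hx0, Real.rpow_one]; ring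
  rcases le_total ‖x‖ ‖x - y‖ with h | h
  · have : ‖x‖ / ‖x - y‖ ≤ 1 := div_le_one_of_le₀ h (norm_nonneg _)
    nlinarith
  · rw [h2]
    have : ‖x‖ ^ (-(1 + δ)) * ‖x - y‖⁻¹ ≤ radialMajorant δ (x - y) := by
      rw [radialMajorant]
      split_ifs with hz
      · refine mul_le_of_le_one_left (by positivity) ?_
        exact Real.rpow_le_one_of_one_le_of_nonpos hx (by linarith)
      · have hz0 : 0 < ‖x - y‖ := by linarith
        rw [show -(2 + δ) = -(1 + δ) + -1 by ring, Real.rpow_add hz0, Real.rpow_neg_one]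
        refine mul_le_mul_of_nonneg_right ?_ (by positivity)
        exact Real.rpow_le_rpow_of_nonpos hz0 h (by linarith)
    linarith

/-- By Tonelli, integrate in `x` first: translation invariance makes the inner integral independent
of `y`. -/
lemma lintegral_radialMajorant_lt_top {δ K : ℝ} (hδ : 0 < δ) (hK : 0 ≤ K) {w : Plane → ℝ}
    (hw : Integrable w) :
    ∫⁻ x, ∫⁻ y, ENNReal.ofReal (K * (2 * radialMajorant δ x + radialMajorant δ (x - y))) *
      ENNReal.ofReal (w y) < ⊤ := by
  have hG := radialMajorant_integrable hδ
  have hmeas : Measurable (radialMajorant δ) := by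
    unfold radialMajorant
    exact Measurable.ite (measurableSet_lt measurable_norm measurable_const) (by fun_prop)
      (by fun_prop)
  rw [lintegral_lintegral_swap]
  · have hin (y : Plane) :
        ∫⁻ x, ENNReal.ofReal (K * (2 * radialMajorant δ x + radialMajorant δ (x - y))) *
          ENNReal.ofReal (w y) =
        ENNReal.ofReal (K * (3 * ∫ z, radialMajorant δ z)) * ENNReal.ofReal (w y) := by
      rw [lintegral_mul_const' _ _ ENNReal.ofReal_ne_top, ← ofReal_integral_eq_lintegral_ofReal]
      · rw [integral_const_mul, integral_add (hG.const_mul 2) (hG.comp_sub_right y),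
          integral_const_mul, integral_sub_right_eq_self (radialMajorant δ) y]
        congr 3; ring
      · exact ((hG.const_mul 2).add (hG.comp_sub_right y)).const_mul K
      · exact ae_of_all _ fun x => mul_nonneg hK (by
          have := radialMajorant_nonneg δ x
          have := radialMajorant_nonneg δ (x - y)
          linarith)
    simp only [hin]
    rw [lintegral_const_mul' _ _ ENNReal.ofReal_ne_top]
    refine ENNReal.mul_lt_top ENNReal.ofReal_lt_top ?_
    exact (lintegral_mono fun y => Real.ofReal_le_enorm (w y)).trans_lt hw.hasFiniteIntegral
  · have h1 : AEMeasurable (fun p : Plane × Plane => ENNReal.ofReal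
        (K * (2 * radialMajorant δ p.1 + radialMajorant δ (p.1 - p.2)))) (volume.prod volume) :=
      Measurable.aemeasurable (by fun_prop)
    exact h1.mul hw.aemeasurable.ennreal_ofReal.comp_snd

lemma tendsto_setIntegral_lt_norm {w : Plane → ℝ} (hw : Integrable w) :
    Tendsto (fun ρ : ℝ => ∫ y in {y : Plane | ρ / 2 < ‖y‖}, w y) atTop (𝓝 0) := by
  have h := tendsto_setIntegral_of_antitone (μ := volume) (f := w)
    (s := fun ρ : ℝ => {y : Plane | ρ / 2 < ‖y‖})
    (fun ρ => measurableSet_lt measurable_const measurable_norm)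
    (fun ρ σ hρσ y (hy : σ / 2 < ‖y‖) => show ρ / 2 < ‖y‖ by linarith) ⟨0, hw.integrableOn⟩
  have hempty : ⋂ ρ : ℝ, {y : Plane | ρ / 2 < ‖y‖} = ∅ := by
    refine eq_empty_of_forall_notMem fun y hy => ?_
    have := mem_iInter.1 hy (2 * ‖y‖)
    simp at this
  simpa [hempty] using h

lemma setIntegral_exp_lt_norm_pos {u : Plane → ℝ} (he : Integrable fun y => Real.exp (u y))
    (r : ℝ) : 0 < ∫ y in {y : Plane | r < ‖y‖}, Real.exp (u y) := by
  have hne : (volume.restrict {y : Plane | r < ‖y‖}) ≠ 0 := by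
    rw [Ne, Measure.restrict_eq_zero]
    refine (IsOpen.measure_pos _ (isOpen_lt continuous_const continuous_norm) ?_).ne'
    obtain ⟨y, hy⟩ := NormedSpace.exists_lt_norm ℝ Plane r
    exact ⟨y, hy⟩
  have : NeZero (volume.restrict {y : Plane | r < ‖y‖}) := ⟨hne⟩
  exact integral_exp_pos he.integrableOn

lemma integrable_exp_mul_logCutoff {u f : Plane → ℝ} (h : IsWeakPoissonSolution u f)
    (hf : Integrable f) (hle : ∀ y, f y ≤ 2 * Real.exp (u y))
    (he : Integrable fun y => Real.exp (u y)) (hβ : 4 * Real.pi < ∫ y, f y) :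
    Integrable fun y => Real.exp (u y) * logCutoff (‖y‖ ^ 2) := by
  obtain ⟨δ, hδ, C, hC⟩ := h.exists_annularMean_le_log hf hβ he
  obtain ⟨ρ, hmean, hmπ, hρ⟩ := (hC.and (((tendsto_setIntegral_lt_norm he).eventually
    (gt_mem_nhds Real.pi_pos)).and (eventually_ge_atTop 1))).exists
  have hm0 := setIntegral_exp_lt_norm_pos he (ρ / 2)
  generalize hm : ∫ y in {y : Plane | ρ / 2 < ‖y‖}, Real.exp (u y) = m at hm0 hmπ
  have hρ0 : 0 < ρ := by linarith
  -- `4/δ` comes from bounding the logarithm by a power, which spends half of `δ`; the further 2 is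
  -- the factor in `2(1 + |x|/|y-x|)`.
  set K := Real.exp C * (8 / δ) with hK
  set Φ : Plane → Plane → ENNReal := fun x y =>
    ENNReal.ofReal (K * (2 * radialMajorant (δ / 2) x + radialMajorant (δ / 2) (x - y))) *
      ENNReal.ofReal (Real.exp (u y) / m) with hΦ
  have hbound : ∀ᵐ x, ENNReal.ofReal (Real.exp (u x) * logCutoff (‖x‖ ^ 2)) ≤
      ENNReal.ofReal (Real.exp (u x) * logCutoff (ρ ^ 2)) + ∫⁻ y, Φ x y := by
    filter_upwards [ae_tendsto_annularMean h.locallyIntegrable] with x hx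
    rcases le_total ‖x‖ ρ with hxρ | hxρ
    · refine le_add_right (ENNReal.ofReal_le_ofReal ?_)
      refine mul_le_mul_of_nonneg_left (logCutoff_monotone ?_) (Real.exp_pos _).le
      gcongr
    refine le_add_left ?_
    have hx1 : 1 ≤ ‖x‖ := hρ.trans hxρ
    have hx0 : 0 < ‖x‖ := by linarith
    have hlim : ENNReal.ofReal (Real.exp (u x)) ≤
        ENNReal.ofReal (Real.exp (annularMean u x (‖x‖ ^ 2 / 16))) *
          ∫⁻ y, ENNReal.ofReal (2 * (1 + ‖x‖ / ‖y - x‖)) *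
            ENNReal.ofReal (Real.exp (u y) / m) := by
      -- Let `a` tend to zero: the annular means converge to `u x` at almost every point, while the
      -- bound does not change.
      refine le_of_tendsto (((ENNReal.continuous_ofReal.comp
        Real.continuous_exp).tendsto _).comp hx) ?_
      filter_upwards [self_mem_nhdsWithin,
        nhdsWithin_le_nhds (Iio_mem_nhds (show 0 < ‖x‖ ^ 2 / 16 by positivity))] with a ha ha'
      exact exp_annularMean_le_lintegral h hf hle he hρ0 hm hm0 hmπ.le hxρ ha (le_of_lt ha')
    have hcoef : Real.exp (annularMean u x (‖x‖ ^ 2 / 16)) * logCutoff (‖x‖ ^ 2) ≤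
        Real.exp C * (4 / δ) * ‖x‖ ^ (-(2 + δ / 2)) := by
      have h1 : Real.exp (annularMean u x (‖x‖ ^ 2 / 16)) ≤
          Real.exp C * ‖x‖ ^ (-(2 + δ)) := by
        rw [Real.rpow_def_of_pos hx0, ← Real.exp_add]
        refine Real.exp_le_exp.2 ((hmean x hxρ).trans_eq ?_)
        ring
      have h2 : logCutoff (‖x‖ ^ 2) ≤ 4 / δ * ‖x‖ ^ (δ / 2) := by
        refine (logCutoff_le_log (one_le_pow₀ hx1)).trans ?_
        rw [Real.log_pow]
        have := Real.log_le_rpow_div (norm_nonneg x) (half_pos hδ)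
        rw [show 4 / δ * ‖x‖ ^ (δ / 2) = 2 * (‖x‖ ^ (δ / 2) / (δ / 2)) by field_simp; ring]
        push_cast
        linarith
      calc _ ≤ Real.exp C * ‖x‖ ^ (-(2 + δ)) * (4 / δ * ‖x‖ ^ (δ / 2)) :=
            mul_le_mul h1 h2 (logCutoff_nonneg _) (by positivity)
        _ = _ := by
            rw [show -(2 + δ / 2) = -(2 + δ) + δ / 2 by ring, Real.rpow_add hx0]
            ring
    calc ENNReal.ofReal (Real.exp (u x) * logCutoff (‖x‖ ^ 2))
        = ENNReal.ofReal (logCutoff (‖x‖ ^ 2)) * ENNReal.ofReal (Real.exp (u x)) := by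
          rw [mul_comm, ENNReal.ofReal_mul (logCutoff_nonneg _)]
      _ ≤ ENNReal.ofReal (logCutoff (‖x‖ ^ 2)) * _ := mul_le_mul' le_rfl hlim
      _ = ENNReal.ofReal (Real.exp (annularMean u x (‖x‖ ^ 2 / 16)) * logCutoff (‖x‖ ^ 2)) *
            ∫⁻ y, ENNReal.ofReal (2 * (1 + ‖x‖ / ‖y - x‖)) *
              ENNReal.ofReal (Real.exp (u y) / m) := by
          rw [ENNReal.ofReal_mul (Real.exp_pos _).le]; ring
      _ = ∫⁻ y, ENNReal.ofReal
            (Real.exp (annularMean u x (‖x‖ ^ 2 / 16)) * logCutoff (‖x‖ ^ 2)) *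
            (ENNReal.ofReal (2 * (1 + ‖x‖ / ‖y - x‖)) * ENNReal.ofReal (Real.exp (u y) / m)) :=
          (lintegral_const_mul' _ _ ENNReal.ofReal_ne_top).symm
      _ ≤ ∫⁻ y, Φ x y := by
          refine lintegral_mono fun y => ?_
          rw [← mul_assoc, ← ENNReal.ofReal_mul
            (mul_nonneg (Real.exp_pos _).le (logCutoff_nonneg _))]
          refine mul_le_mul' (ENNReal.ofReal_le_ofReal ?_) le_rfl
          have h3 := rpow_mul_le_radialMajorant (half_pos hδ) (y := y) hx1
          calc _ ≤ Real.exp C * (4 / δ) * ‖x‖ ^ (-(2 + δ / 2)) * (2 * (1 + ‖x‖ / ‖y - x‖)) :=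
                mul_le_mul_of_nonneg_right hcoef (by positivity)
            _ = K * (‖x‖ ^ (-(2 + δ / 2)) * (1 + ‖x‖ / ‖y - x‖)) := by rw [hK]; ring
            _ ≤ _ := mul_le_mul_of_nonneg_left h3 (by positivity)
  have hcont : Continuous fun y : Plane => logCutoff (‖y‖ ^ 2) :=
    logCutoff_continuous.comp (by fun_prop)
  refine ⟨he.aestronglyMeasurable.mul hcont.aestronglyMeasurable, ?_⟩
  rw [hasFiniteIntegral_iff_ofReal
    (ae_of_all _ fun y => mul_nonneg (Real.exp_pos _).le (logCutoff_nonneg _))]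
  refine (lintegral_mono_ae hbound).trans_lt ?_
  rw [lintegral_add_left' (he.mul_const _).aemeasurable.ennreal_ofReal, ENNReal.add_lt_top]
  refine ⟨?_, lintegral_radialMajorant_lt_top (half_pos hδ) (by positivity) (he.div_const m)⟩
  exact (hasFiniteIntegral_iff_ofReal (ae_of_all _ fun y =>
    mul_nonneg (Real.exp_pos _).le (logCutoff_nonneg _))).1 (he.mul_const _).hasFiniteIntegral

/-! ### Lower bounds on the masses -/

lemma IsWeakPoissonSolution.four_pi_le {u f : Plane → ℝ} (h : IsWeakPoissonSolution u f)
    (hf : Integrable f) (he : Integrable fun y => Real.exp (u y)) :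
    4 * Real.pi ≤ ∫ y, f y := by
  by_contra! hlt
  set d := 1 - (4 * Real.pi)⁻¹ * ∫ y, f y with hd
  have hd0 : 0 < d := by
    rw [hd, sub_pos, inv_mul_lt_one₀ (by positivity)]; exact hlt
  obtain ⟨R, h1, h2, hR⟩ := (((tendsto_annularMean_add_log h.locallyIntegrable he).eventually_lt_atBot
    (annularMean u 0 1)).and (((tendsto_integral_innerLogWeight_div_log hf).eventually
      (lt_mem_nhds (neg_lt_zero.2 hd0))).and (eventually_gt_atTop 1))).exists
  have hlog := Real.log_pos hR
  rw [h.annularMean_add_log hf hR.le, ← hd] at h1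
  rw [lt_div_iff₀ hlog] at h2
  linarith

lemma not_both_integral_eq_four_pi {u₁ f₁ u₂ f₂ : Plane → ℝ} (h₁ : IsWeakPoissonSolution u₁ f₁)
    (h₂ : IsWeakPoissonSolution u₂ f₂) (hf₁ : Integrable f₁) (hf₂ : Integrable f₂)
    (he₁ : Integrable fun y => Real.exp (u₁ y)) (he₂ : Integrable fun y => Real.exp (u₂ y))
    (hpos : ∀ y, 0 ≤ f₁ y + f₂ y) (hβ₁ : ∫ y, f₁ y = 4 * Real.pi) :
    ∫ y, f₂ y ≠ 4 * Real.pi := by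
  intro hβ₂
  have hpi : (4 * Real.pi) ≠ 0 := by positivity
  obtain ⟨R, h3, h4, hR⟩ := (((tendsto_annularMean_add_log h₁.locallyIntegrable he₁).eventually_lt_atBot
    (annularMean u₁ 0 1)).and (((tendsto_annularMean_add_log h₂.locallyIntegrable
      he₂).eventually_lt_atBot (annularMean u₂ 0 1)).and (eventually_gt_atTop 1))).exists
  rw [h₁.annularMean_add_log hf₁ hR.le, hβ₁, inv_mul_cancel₀ hpi] at h3
  rw [h₂.annularMean_add_log hf₂ hR.le, hβ₂, inv_mul_cancel₀ hpi] at h4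
  have h5 : 0 ≤ (∫ y, f₁ y * innerLogWeight R y) + ∫ y, f₂ y * innerLogWeight R y := by
    rw [← integral_add (integrable_mul_innerLogWeight hf₁ hR.le)
      (integrable_mul_innerLogWeight hf₂ hR.le)]
    refine integral_nonneg fun y => ?_
    rw [← add_mul]
    exact mul_nonneg (hpos y) (innerLogWeight_nonneg hR.le y)
  linarith

/-- At the critical mass the `log R` term drops out, and the lower bound on `f` keeps the remaining
integral above `-B` for all `R > 1`, while the mean plus `log R` tends to `-∞`. -/
lemma integral_ne_four_pi_of_integrable_logCutoff {u f v : Plane → ℝ}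
    (h : IsWeakPoissonSolution u f) (hf : Integrable f)
    (he : Integrable fun y => Real.exp (u y)) (hge : ∀ y, -Real.exp (v y) ≤ f y)
    (hv : Integrable fun y => Real.exp (v y) * logCutoff (‖y‖ ^ 2)) :
    ∫ y, f y ≠ 4 * Real.pi := by
  intro hβ
  have hpi : (4 * Real.pi) ≠ 0 := by positivity
  set B := ∫ y, Real.exp (v y) * logCutoff (‖y‖ ^ 2) * (4 * Real.pi)⁻¹
  obtain ⟨R, h3, hR⟩ := (((tendsto_annularMean_add_log h.locallyIntegrable he).eventually_lt_atBot
    (annularMean u 0 1 - B)).and (eventually_gt_atTop 1)).exists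
  rw [h.annularMean_add_log hf hR.le, hβ, inv_mul_cancel₀ hpi] at h3
  have h5 : -B ≤ ∫ y, f y * innerLogWeight R y := by
    rw [← integral_neg]
    refine integral_mono (hv.mul_const _).neg (integrable_mul_innerLogWeight hf hR.le) fun y => ?_
    have h6 := mul_le_mul_of_nonneg_right (hge y) (innerLogWeight_nonneg hR.le y)
    have h7 := mul_le_mul_of_nonneg_left (innerLogWeight_le_logCutoff R y) (Real.exp_pos (v y)).le
    simp only
    linarith
  linarith

/-- Every entire solution `(u₁, u₂) ∈ H¹_loc × H¹_loc` of the `SU(3)` Toda system with finite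
masses `α_j = ∫ e^{u_j}` satisfies `2 α₁ - α₂ > 4π`, `2 α₂ - α₁ > 4π`, `α₁ > 4π`, `α₂ > 4π`. -/
theorem corollary2p6 (u₁ u₂ : Plane → ℝ)
    (hsol : IsEntireTodaSolution u₁ u₂)
    (hfin₁ : MeasureTheory.Integrable (fun x : Plane => Real.exp (u₁ x)))
    (hfin₂ : MeasureTheory.Integrable (fun x : Plane => Real.exp (u₂ x))) :
    (2 * todaMass u₁ - todaMass u₂ > 4 * Real.pi ∧
      2 * todaMass u₂ - todaMass u₁ > 4 * Real.pi) ∧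
    (todaMass u₁ > 4 * Real.pi ∧ todaMass u₂ > 4 * Real.pi) := by
  obtain ⟨h₁, h₂⟩ := hsol
  have e₁ (x : Plane) := Real.exp_pos (u₁ x)
  have e₂ (x : Plane) := Real.exp_pos (u₂ x)
  have hf₁ := (hfin₁.const_mul 2).sub hfin₂
  have hf₂ := hfin₁.neg.add (hfin₂.const_mul 2)
  have hi₁ : ∫ x, (2 * Real.exp (u₁ x) - Real.exp (u₂ x)) = 2 * todaMass u₁ - todaMass u₂ := by
    rw [integral_sub (hfin₁.const_mul 2) hfin₂, integral_const_mul, todaMass, todaMass]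
  have hi₂ : ∫ x, (-Real.exp (u₁ x) + 2 * Real.exp (u₂ x)) = 2 * todaMass u₂ - todaMass u₁ := by
    have hn : Integrable fun x => -Real.exp (u₁ x) := hfin₁.neg
    rw [integral_add hn (hfin₂.const_mul 2), integral_const_mul, integral_neg, todaMass,
      todaMass]
    ring
  have hge₁ := h₁.four_pi_le hf₁ hfin₁
  have hge₂ := h₂.four_pi_le hf₂ hfin₂
  have hnot := not_both_integral_eq_four_pi h₁ h₂ hf₁ hf₂ hfin₁ hfin₂
    fun x => by linarith [e₁ x, e₂ x]
  have hne₁ (hlt : 4 * Real.pi < 2 * todaMass u₂ - todaMass u₁) :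
      2 * todaMass u₁ - todaMass u₂ ≠ 4 * Real.pi := by
    rw [← hi₁]
    exact integral_ne_four_pi_of_integrable_logCutoff h₁ hf₁ hfin₁
      (fun x => by linarith [e₁ x]) (integrable_exp_mul_logCutoff h₂ hf₂
        (fun x => by linarith [e₁ x]) hfin₂ (hlt.trans_eq hi₂.symm))
  have hne₂ (hlt : 4 * Real.pi < 2 * todaMass u₁ - todaMass u₂) :
      2 * todaMass u₂ - todaMass u₁ ≠ 4 * Real.pi := by
    rw [← hi₂]
    exact integral_ne_four_pi_of_integrable_logCutoff h₂ hf₂ hfin₂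
      (fun x => by linarith [e₂ x]) (integrable_exp_mul_logCutoff h₁ hf₁
        (fun x => by linarith [e₂ x]) hfin₁ (hlt.trans_eq hi₁.symm))
  rw [hi₁] at hge₁ hnot
  rw [hi₂] at hge₂ hnot
  have key : 4 * Real.pi < 2 * todaMass u₁ - todaMass u₂ ∧
      4 * Real.pi < 2 * todaMass u₂ - todaMass u₁ := by
    rcases hge₁.eq_or_lt with h | h <;> rcases hge₂.eq_or_lt with h' | h'
    · exact absurd h'.symm (hnot h.symm)
    · exact absurd h.symm (hne₁ h')
    · exact absurd h'.symm (hne₂ h)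
    · exact ⟨h, h'⟩
  -- Inverting the Cartan matrix: `3α₁ = 2β₁ + β₂` and `3α₂ = β₁ + 2β₂`.
  exact ⟨key, by linarith [key.1, key.2], by linarith [key.1, key.2]⟩
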